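/- Let $0<\alpha<1$, $\rho>0$, $\mu>0$ and $0<\tau\le 1$. Let $f_G(y,t)=\frac{\mu^{\rho t}}{\Gamma(\rho t)}\,y^{\rho t-1}e^{-\mu y}$ ($y,t>0$) be the density of the gamma subordinator, let $g_\alpha(x,y)=\frac1{2\pi}\int_{\mathbb R}e^{-i\theta x}\,e^{-y(-i\theta)^\alpha}\,d\theta$ (principal branch; $x,y>0$) be the density at time $y$ of the $\alpha$-stable subordinator with Laplace transform $e^{-yu^\alpha}$, and let $$f_{M_{\alpha,\rho,\mu}(t)}(x)=\sum_{k=0}^\infty(-1)^k\,\frac{\mu^{\rho t+k}\,\Gamma(\rho t+k)}{\Gamma(\rho t)\,\Gamma(k+1)}\;\frac{x^{\alpha(\rho t+k)-1}}{\Gamma(\alpha(\rho t+k))},\qquad x,t>0,$$ be the density of the Mittag-Leffler Lévy process, whose Laplace transform is $\left(\mu/(\mu+u^\alpha)\right)^{\rho t}$. Let $\psi=\Gamma'/\Gamma$ be the digamma function. For $\nu>0$ put $\frac{\partial^{-\nu}}{\partial t^{-\nu}}h(t)=\frac1{\Gamma(\nu)}\int_0^t(t-u)^{\nu-1}h(u)\,du$,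 let $\frac{\partial^{0}}{\partial t^{0}}h=h$, and for $0<\tau\le1$ let $\frac{\partial^{\tau}}{\partial t^{\tau}}h=\frac{d}{dt}\,\frac{\partial^{\tau-1}}{\partial t^{\tau-1}}h$ (Riemann–Liouville operators with base point $0$). Then for all $x>0$ and $t>0$ $$\frac{\partial^\tau}{\partial t^\tau}f_{M_{\alpha,\rho,\mu}(t)}(x)=\rho\,\frac{\partial^{\tau-1}}{\partial t^{\tau-1}}\left[\bigl(\log\mu-\psi(\rho t)\bigr)f_{M_{\alpha,\rho,\mu}(t)}(x)+\int_0^\infty g_\alpha(x,y)\,(\log y)\,f_G(y,t)\,dy\right],$$ where all the integrals converge absolutely and the derivative on the left-hand side exists. -/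

import Mathlib

open MeasureTheory ProbabilityTheory Set

noncomputable section

namespace FracML

/-- Riemann-Liouville integral of order `ν ≥ 0` with base point `0`, the identity for `ν = 0`:
`(I^ν f)(t) = Γ(ν)⁻¹ ∫₀ᵗ (t - u)^(ν - 1) f(u) du`. -/
def rlIntegral (ν : ℝ) (f : ℝ → ℝ) (t : ℝ) : ℝ :=
  if ν = 0 then f t else (Real.Gamma ν)⁻¹ * ∫ u in (0 : ℝ)..t, (t - u) ^ (ν - 1) * f u

/-- The integral in `rlIntegral ν f t` converges absolutely (no condition for `ν = 0`). -/
def RLIntegrable (ν : ℝ) (f : ℝ → ℝ) (t : ℝ) : Prop :=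
  ν = 0 ∨ IntervalIntegrable (fun u => (t - u) ^ (ν - 1) * f u) volume 0 t

/-- Riemann-Liouville operator `∂^σ/∂t^σ` of real order `σ` with base point `0`:
`(d/dt)^n I^(n - σ)` with `n = ⌈σ⌉` for `σ > 0`, and the integral `I^(-σ)` for `σ ≤ 0`
(where `⌈σ⌉₊ = 0`). -/
def rlDeriv (σ : ℝ) (f : ℝ → ℝ) (t : ℝ) : ℝ :=
  iteratedDeriv ⌈σ⌉₊ (rlIntegral ((⌈σ⌉₊ : ℝ) - σ) f) t

/-- The digamma function on the reals. -/
def digamma (s : ℝ) : ℝ := (Complex.digamma (s : ℂ)).re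

/-- Density at `x` of the `α`-stable subordinator at time `y > 0` (Laplace transform
`exp (-y u^α)`), as the Fourier inverse of its characteristic function
`θ ↦ exp (-y (-iθ)^α)`, with the principal branch of the power. -/
def stableDensity (α x y : ℝ) : ℝ :=
  (2 * Real.pi)⁻¹ *
    (∫ θ : ℝ, Complex.exp (-(Complex.I * θ * x)) *
      Complex.exp (-((y : ℂ) * (-(Complex.I * θ)) ^ (α : ℂ)))).re

/-- Density at `x > 0` of the gamma subordinator at time `t > 0`:
`μ^(ρ t) / Γ(ρ t) * x^(ρ t - 1) * exp (-μ x)`. -/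
def gammaDensity (ρ μ x t : ℝ) : ℝ := gammaPDFReal (ρ * t) μ x

/-- Density at `x > 0` of the Mittag-Leffler Lévy process at time `t > 0`. -/
def mlDensity (α ρ μ x t : ℝ) : ℝ :=
  ∑' k : ℕ, (-1) ^ k *
    (μ ^ (ρ * t + k) * Real.Gamma (ρ * t + k) / (Real.Gamma (ρ * t) * Real.Gamma (k + 1))) *
    (x ^ (α * (ρ * t + k) - 1) / Real.Gamma (α * (ρ * t + k)))

/-- The function of `t` inside the operator on the right-hand side of the equation. -/
def mlBracket (α ρ μ x t : ℝ) : ℝ :=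
  (Real.log μ - digamma (ρ * t)) * mlDensity α ρ μ x t +
    ∫ y in Ioi (0 : ℝ), stableDensity α x y * Real.log y * gammaDensity ρ μ y t

end FracML

end

/-! Put s = ρt. Subordination writes the density as F(s) = μ^s Γ(s)⁻¹ ∫₀^∞ y^(s-1) e^(-μy) g_α(x,y)
dy, elementary factors times a Mellin transform in y (`mlDensity_eq_integral`). For fixed x > 0,
g_α(x,y) is O(y) at y = 0 and decays faster than any exponential (`exists_abs_stableDensity_le`).
Hence F is holomorphic on Re s > -1, which contains s = 0, and F(0) = 0 because 1/Γ vanishes there.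
By the product rule the bracket is F'(ρt) (`mlBracket_eq_mlRealDeriv`): the three factors of F
contribute log μ, -ψ and log y. Since F(0) = 0, no boundary term appears when d/dt passes under the
Riemann-Liouville integral (`hasDerivAt_rlIntegral`); the chain rule supplies the factor ρ.

The analytic work is on g_α. Its Fourier integral is a Bromwich integral over the imaginary axis;
Cauchy's theorem moves it to Re u = c, and two integrations by parts exchange a factor x² for the
second u-derivative of e^(-y u^α). That derivative is bounded by a multiple of y e^(-ky) |u|^(α-2),
integrable along the line, with k growing with c (`norm_stableExpDeriv₂_le`). The same bound
justifies Fubini against y^(s-1), giving the Mellin transform Γ(s) x^(αs-1)/Γ(αs)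
(`integral_rpow_mul_stableDensity`); expanding e^(-μy) termwise then recovers the defining series.
-/

namespace FracML

open Filter Topology

/-! ### Size and regularity of exp (-y u ^ α) on the closed right half-plane. -/

/-- On the right half-plane the power `u ^ α`, `0 < α < 1`, stays in a sector around the positive
axis. -/
lemma norm_rpow_mul_cos_le_re_cpow {α : ℝ} (hα0 : 0 < α) (hα1 : α < 1) {u : ℂ} (hu : 0 ≤ u.re) :
    ‖u‖ ^ α * Real.cos (α * (Real.pi / 2)) ≤ (u ^ (α : ℂ)).re := by
  rcases eq_or_ne u 0 with rfl | h0
  · simp [hα0.ne']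
  have harg := Complex.abs_arg_le_pi_div_two_iff.2 hu
  have h1 : (u ^ (α : ℂ)).re = ‖u‖ ^ α * Real.cos (α * u.arg) := by
    rw [Complex.cpow_def_of_ne_zero h0, Complex.exp_re, Complex.re_mul_ofReal,
      Complex.im_mul_ofReal, Complex.log_re, Complex.log_im,
      Real.rpow_def_of_pos (norm_pos_iff.2 h0), mul_comm u.arg]
  rw [h1]
  gcongr
  rw [← Real.cos_abs (α * u.arg), abs_mul, abs_of_pos hα0]
  apply Real.cos_le_cos_of_nonneg_of_le_pi
  · positivity
  · nlinarith [Real.pi_pos]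
  · gcongr

lemma cos_mul_pi_div_two_pos {α : ℝ} (hα0 : 0 < α) (hα1 : α < 1) :
    0 < Real.cos (α * (Real.pi / 2)) := by
  apply Real.cos_pos_of_mem_Ioo
  constructor <;> nlinarith [Real.pi_pos]

/-- The point `c + i v` of the vertical line with abscissa `c`. -/
noncomputable def vline (c v : ℝ) : ℂ := c + v * Complex.I

@[simp] lemma vline_re (c v : ℝ) : (vline c v).re = c := by simp [vline]

@[simp] lemma vline_im (c v : ℝ) : (vline c v).im = v := by simp [vline]

lemma abs_le_norm_vline (c v : ℝ) : |v| ≤ ‖vline c v‖ := by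
  simpa using Complex.abs_im_le_norm (vline c v)

lemma le_norm_vline (c v : ℝ) : c ≤ ‖vline c v‖ := by
  simpa using Complex.re_le_norm (vline c v)

lemma continuous_vline (c : ℝ) : Continuous (vline c) := by
  unfold vline; fun_prop

lemma hasDerivAt_vline (c v : ℝ) : HasDerivAt (vline c) Complex.I v := by
  have := ((Complex.ofRealCLM.hasDerivAt (x := v)).mul_const Complex.I).const_add (c : ℂ)
  exact this.congr_deriv (by simp)

/-- The Laplace exponent factor `exp (-y u ^ α)`. -/
noncomputable def stableExp (α y : ℝ) (u : ℂ) : ℂ := Complex.exp (-(y * u ^ (α : ℂ)))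

/-- The sector bound makes the decay hold up to the imaginary axis itself, where the density is
originally defined. -/
lemma norm_stableExp_le {α y : ℝ} (hα0 : 0 < α) (hα1 : α < 1) (hy : 0 ≤ y) {u : ℂ}
    (hu : 0 ≤ u.re) :
    ‖stableExp α y u‖ ≤ Real.exp (-(y * Real.cos (α * (Real.pi / 2)) * ‖u‖ ^ α)) := by
  rw [stableExp, Complex.norm_exp]
  gcongr
  rw [Complex.neg_re, Complex.re_ofReal_mul, mul_assoc]
  gcongr
  rw [mul_comm]
  exact norm_rpow_mul_cos_le_re_cpow hα0 hα1 hu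

/-- The branch cut meets the closed half-plane only at 0, where a positive exponent restores
continuity. -/
lemma continuousAt_cpow_of_re_nonneg {α : ℝ} (hα0 : 0 < α) {u : ℂ} (hu : 0 ≤ u.re) :
    ContinuousAt (fun z : ℂ => z ^ (α : ℂ)) u := by
  rcases eq_or_ne u 0 with rfl | h0
  · have h := Complex.continuousAt_cpow_zero_of_re_pos (z := (α : ℂ)) (by simpa using hα0)
    exact ContinuousAt.comp_of_eq (f := fun z : ℂ => (z, (α : ℂ))) h (by fun_prop) rfl
  · apply continuousAt_cpow_const
    rcases hu.lt_or_eq with h | h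
    · exact Or.inl h
    · refine Or.inr fun hi => h0 (Complex.ext h.symm hi)

lemma continuousAt_stableExp {α : ℝ} (hα0 : 0 < α) (y : ℝ) {u : ℂ} (hu : 0 ≤ u.re) :
    ContinuousAt (stableExp α y) u := by
  have := continuousAt_cpow_of_re_nonneg hα0 hu
  unfold stableExp
  fun_prop

lemma hasDerivAt_stableExp (α y : ℝ) {u : ℂ} (hu : 0 < u.re) :
    HasDerivAt (stableExp α y) (-(y * α * u ^ ((α : ℂ) - 1)) * stableExp α y u) u := by
  have h := (((hasDerivAt_id u).cpow_const (c := (α : ℂ)) (Or.inl hu)).const_mul (y : ℂ)).neg.cexp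
  refine h.congr_deriv ?_
  change Complex.exp (-(y * u ^ (α : ℂ))) * -(y * (α * u ^ ((α : ℂ) - 1) * 1)) = _
  rw [stableExp]
  ring

lemma integrable_exp_neg_mul_abs_rpow {α b : ℝ} (hα0 : 0 < α) (hb : 0 < b) :
    Integrable fun v : ℝ => Real.exp (-(b * |v| ^ α)) := by
  have h := integrableOn_rpow_mul_exp_neg_mul_rpow (s := 0) (by norm_num) hα0 hb
  have h' : IntegrableOn (fun v : ℝ => Real.exp (-(b * |v| ^ α))) (Ioi 0) := by
    refine h.congr_fun (fun v hv => ?_) measurableSet_Ioi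
    simp [abs_of_pos (show 0 < v from hv)]
  have h2 : IntegrableOn (fun v : ℝ => Real.exp (-(b * |v| ^ α))) (Iic 0) := by
    have m : MeasurableEmbedding fun v : ℝ => -v := (Homeomorph.neg ℝ).measurableEmbedding
    rw [← Measure.map_neg_eq_self (volume : Measure ℝ), m.integrableOn_map_iff]
    simp only [Function.comp_def, abs_neg, neg_preimage, neg_Iic, neg_zero]
    exact Iff.mpr integrableOn_Ici_iff_integrableOn_Ioi h'
  rw [← integrableOn_univ, ← Iic_union_Ioi (a := (0 : ℝ))]
  exact h2.union h'

lemma continuous_stableExp_vline {α : ℝ} (hα0 : 0 < α) (y : ℝ) {c : ℝ} (hc : 0 ≤ c) :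
    Continuous fun v => stableExp α y (vline c v) :=
  continuous_iff_continuousAt.2 fun v =>
    ContinuousAt.comp (g := stableExp α y) (continuousAt_stableExp hα0 y (by simpa using hc))
      (continuous_vline c).continuousAt

lemma integrable_stableExp_vline {α y c : ℝ} (hα0 : 0 < α) (hα1 : α < 1) (hy : 0 < y)
    (hc : 0 ≤ c) : Integrable fun v => stableExp α y (vline c v) := by
  have hk := cos_mul_pi_div_two_pos hα0 hα1
  refine (integrable_exp_neg_mul_abs_rpow hα0 (mul_pos hy hk)).mono'
    (continuous_stableExp_vline hα0 y hc).aestronglyMeasurable (ae_of_all _ fun v => ?_)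
  refine (norm_stableExp_le hα0 hα1 hy.le (by simpa using hc)).trans ?_
  gcongr
  exact abs_le_norm_vline c v

lemma norm_exp_vline_mul (c v x : ℝ) :
    ‖Complex.exp (vline c v * x)‖ = Real.exp (c * x) := by
  rw [Complex.norm_exp, Complex.re_mul_ofReal, vline_re]

lemma continuous_exp_vline_mul (c x : ℝ) : Continuous fun v => Complex.exp (vline c v * x) := by
  have := continuous_vline c
  fun_prop

lemma _root_.MeasureTheory.Integrable.exp_vline_mul {f : ℝ → ℂ} (hf : Integrable f) (c x : ℝ) :
    Integrable fun v => Complex.exp (vline c v * x) * f v :=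
  hf.bdd_mul (continuous_exp_vline_mul c x).aestronglyMeasurable
    (ae_of_all _ fun v => (norm_exp_vline_mul c v x).le)

/-! ### Shifting the contour. -/

/-- The Bromwich integral of `exp (-y u ^ α)` does not depend on the vertical line. -/
lemma integral_exp_mul_stableExp_eq {α x y c : ℝ} (hα0 : 0 < α) (hα1 : α < 1) (hy : 0 < y)
    (hx : 0 < x) (hc : 0 ≤ c) :
    ∫ v, Complex.exp (vline 0 v * x) * stableExp α y (vline 0 v) =
      ∫ v, Complex.exp (vline c v * x) * stableExp α y (vline c v) := by
  set f : ℂ → ℂ := fun u => Complex.exp (u * x) * stableExp α y u with hf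
  have hk := cos_mul_pi_div_two_pos hα0 hα1
  have hcont : ∀ u : ℂ, 0 ≤ u.re → ContinuousAt f u := fun u hu => by
    have := continuousAt_stableExp hα0 y hu
    fun_prop
  have hdiff : ∀ u : ℂ, 0 < u.re → DifferentiableAt ℂ f u := fun u hu => by
    have := (hasDerivAt_stableExp α y hu).differentiableAt
    fun_prop
  have hrect : ∀ T : ℝ,
      (((∫ s in (0 : ℝ)..c, f (s + (-T : ℝ) * Complex.I)) -
        ∫ s in (0 : ℝ)..c, f (s + T * Complex.I)) +
        Complex.I * ∫ v in (-T)..T, f (vline c v)) -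
        Complex.I * ∫ v in (-T)..T, f (vline 0 v) = 0 := fun T => by
    have h := Complex.integral_boundary_rect_eq_zero_of_continuousOn_of_differentiableOn f
      (vline 0 (-T)) (vline c T) (fun u hu => (hcont u ?_).continuousWithinAt)
      (fun u hu => (hdiff u ?_).differentiableWithinAt)
    · simpa [vline] using h
    · have := hu.1
      simp only [mem_preimage, vline_re, uIcc_of_le hc] at this
      exact this.1
    · have := hu.1
      simp only [mem_preimage, vline_re, min_eq_left hc] at this
      exact this.1
  -- The sign σ = ±1 treats both horizontal sides at once; on them |u| ≥ T, so the integrand is at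
  -- most e^(cx) e^(-yκT^α), where κ = cos(απ/2).
  have hside : ∀ σ : ℝ, |σ| = 1 → Tendsto (fun T : ℝ => ∫ s in (0 : ℝ)..c,
      f (s + (σ * T : ℝ) * Complex.I)) atTop (𝓝 0) := fun σ hσ => by
    have hlim : Tendsto (fun T : ℝ => Real.exp (c * x) *
        Real.exp (-(y * Real.cos (α * (Real.pi / 2)) * T ^ α)) * |c - 0|) atTop (𝓝 0) := by
      have : Tendsto (fun T : ℝ => y * Real.cos (α * (Real.pi / 2)) * T ^ α) atTop atTop :=
        (tendsto_rpow_atTop hα0).const_mul_atTop (mul_pos hy hk)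
      have := ((Real.tendsto_exp_neg_atTop_nhds_zero.comp this).const_mul
        (Real.exp (c * x))).mul_const |c - 0|
      simpa using this
    refine squeeze_zero_norm' ?_ hlim
    filter_upwards [eventually_ge_atTop 0] with T hT
    refine intervalIntegral.norm_integral_le_of_norm_le_const fun s hs => ?_
    rw [uIoc_of_le hc] at hs
    rw [hf]
    simp only [norm_mul]
    change ‖Complex.exp (vline s (σ * T) * x)‖ * ‖stableExp α y (vline s (σ * T))‖ ≤ _
    rw [norm_exp_vline_mul]
    have hT' : T ≤ ‖vline s (σ * T)‖ := by
      have := abs_le_norm_vline s (σ * T)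
      rwa [abs_mul, hσ, one_mul, abs_of_nonneg hT] at this
    gcongr
    · exact hs.2
    · refine (norm_stableExp_le hα0 hα1 hy.le (by simpa using hs.1.le)).trans ?_
      gcongr
  have hint : ∀ b : ℝ, 0 ≤ b → Tendsto (fun T : ℝ => ∫ v in (-T)..T, f (vline b v)) atTop
      (𝓝 (∫ v, f (vline b v))) := fun b hb =>
    intervalIntegral_tendsto_integral
      ((integrable_stableExp_vline hα0 hα1 hy hb).exp_vline_mul b x) tendsto_neg_atTop_atBot
      tendsto_id
  have h := (((hside (-1) (by simp)).sub (hside 1 (by simp))).add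
    ((hint c hc).const_mul Complex.I)).sub ((hint 0 le_rfl).const_mul Complex.I)
  have h0 : (0 : ℂ) - 0 + Complex.I * (∫ v, f (vline c v)) - Complex.I * ∫ v, f (vline 0 v) = 0 :=
    tendsto_nhds_unique h (tendsto_const_nhds.congr fun T => by
      rw [neg_one_mul, one_mul]; exact (hrect T).symm)
  have h1 : Complex.I * ((∫ v, f (vline c v)) - ∫ v, f (vline 0 v)) = 0 := by
    rw [← h0]; ring
  rcases mul_eq_zero.1 h1 with h2 | h2
  · exact absurd h2 Complex.I_ne_zero
  · exact (sub_eq_zero.1 h2).symm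

lemma stableDensity_eq_bromwich {α x y c : ℝ} (hα0 : 0 < α) (hα1 : α < 1) (hx : 0 < x)
    (hy : 0 < y) (hc : 0 ≤ c) :
    stableDensity α x y =
      (2 * Real.pi)⁻¹ * (∫ v, Complex.exp (vline c v * x) * stableExp α y (vline c v)).re := by
  -- The reflection θ = -v turns -iθ into iv, the point of the line with abscissa 0.
  rw [← integral_exp_mul_stableExp_eq hα0 hα1 hy hx hc, stableDensity, ← integral_neg_eq_self]
  congr 4 with v
  simp only [vline, stableExp]
  push_cast
  congr 2 <;> ring_nf

/-! ### Integration by parts and pointwise bounds for the stable density. -/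

/-- Integration by parts against `exp (u x)` along a vertical line. -/
lemma mul_integral_exp_vline_mul {c x : ℝ} {Q Q' : ℂ → ℂ}
    (hQ : ∀ v, HasDerivAt Q (Q' (vline c v)) (vline c v))
    (hi : Integrable fun v => Q (vline c v)) (hi' : Integrable fun v => Q' (vline c v)) :
    x * ∫ v, Complex.exp (vline c v * x) * Q (vline c v) =
      -∫ v, Complex.exp (vline c v * x) * Q' (vline c v) := by
  have hE : ∀ v, HasDerivAt (fun v => Complex.exp (vline c v * x))
      (Complex.exp (vline c v * x) * (Complex.I * x)) v := fun v =>
    ((hasDerivAt_vline c v).mul_const (x : ℂ)).cexp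
  have hP : ∀ v, HasDerivAt (fun v => Q (vline c v)) (Q' (vline c v) * Complex.I) v := fun v =>
    (hQ v).comp v (hasDerivAt_vline c v)
  have h := integral_mul_deriv_eq_deriv_mul_of_integrable (fun v _ => hE v) (fun v _ => hP v)
    (((hi'.exp_vline_mul c x).mul_const Complex.I).congr
      (ae_of_all _ fun v => by simp only [Pi.mul_apply]; ring))
    (((hi.exp_vline_mul c x).mul_const (Complex.I * x)).congr
      (ae_of_all _ fun v => by simp only [Pi.mul_apply]; ring))
    (hi.exp_vline_mul c x)
  have h1 : ∫ v, Complex.exp (vline c v * x) * (Q' (vline c v) * Complex.I) =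
      Complex.I * ∫ v, Complex.exp (vline c v * x) * Q' (vline c v) := by
    rw [← integral_const_mul]; congr 1 with v; ring
  have h2 : ∫ v, Complex.exp (vline c v * x) * (Complex.I * x) * Q (vline c v) =
      Complex.I * (x * ∫ v, Complex.exp (vline c v * x) * Q (vline c v)) := by
    rw [← integral_const_mul, ← integral_const_mul]; congr 1 with v; ring
  rw [h1, h2, ← mul_neg_one, mul_assoc] at h
  have := mul_left_cancel₀ Complex.I_ne_zero h
  rw [this]; ring

/-- The second derivative of `exp (-y u ^ α)` in `u`. -/
noncomputable def stableExpDeriv₂ (α y : ℝ) (u : ℂ) : ℂ :=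
  (y * (α * (1 - α)) * u ^ ((α - 2 : ℝ) : ℂ) + (y * α * u ^ ((α - 1 : ℝ) : ℂ)) ^ 2) *
    stableExp α y u

lemma hasDerivAt_stableExp' (α y : ℝ) {u : ℂ} (hu : 0 < u.re) :
    HasDerivAt (stableExp α y) (-(y * α * u ^ ((α - 1 : ℝ) : ℂ)) * stableExp α y u) u := by
  have := hasDerivAt_stableExp α y hu
  push_cast
  exact this

lemma hasDerivAt_deriv_stableExp (α y : ℝ) {u : ℂ} (hu : 0 < u.re) :
    HasDerivAt (fun u => -(y * α * u ^ ((α - 1 : ℝ) : ℂ)) * stableExp α y u)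
      (stableExpDeriv₂ α y u) u := by
  have h1 := (((hasDerivAt_id u).cpow_const (c := ((α - 1 : ℝ) : ℂ)) (Or.inl hu)).const_mul
    (y * α : ℂ)).neg
  refine (h1.mul (hasDerivAt_stableExp' α y hu)).congr_deriv ?_
  have h2 : ((α - 1 : ℝ) : ℂ) - 1 = ((α - 2 : ℝ) : ℂ) := by push_cast; ring
  simp only [stableExpDeriv₂, id, h2]
  push_cast
  simp only [Pi.neg_apply]
  ring

lemma continuous_vline_cpow {c : ℝ} (hc : 0 < c) (a : ℂ) : Continuous fun v => vline c v ^ a :=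
  continuous_iff_continuousAt.2 fun v =>
    ContinuousAt.comp (g := fun u : ℂ => u ^ a) (continuousAt_cpow_const (Or.inl (by simpa using hc)))
      (continuous_vline c).continuousAt

lemma norm_vline_cpow_le {c a : ℝ} (hc : 0 < c) (ha : a ≤ 0) (v : ℝ) :
    ‖vline c v ^ (a : ℂ)‖ ≤ c ^ a := by
  rw [Complex.norm_cpow_real]
  exact Real.rpow_le_rpow_of_nonpos hc (le_norm_vline c v) ha

lemma integrable_vline_cpow_mul {c a : ℝ} (hc : 0 < c) (ha : a ≤ 0) {f : ℝ → ℂ}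
    (hf : Integrable f) : Integrable fun v => vline c v ^ (a : ℂ) * f v :=
  hf.bdd_mul (continuous_vline_cpow hc a).aestronglyMeasurable
    (ae_of_all _ (norm_vline_cpow_le hc ha))

lemma integrable_norm_vline_rpow {c a : ℝ} (hc : 1 ≤ c) (ha : a < -1) :
    Integrable fun v => ‖vline c v‖ ^ a := by
  have h := integrable_rpow_neg_one_add_norm_sq (E := ℝ) (μ := volume) (r := -a)
    (by simp; linarith)
  refine h.mono' ?_ (ae_of_all _ fun v => ?_)
  · refine (Continuous.rpow_const (continuous_vline c).norm fun v => Or.inl ?_).aestronglyMeasurable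
    exact (lt_of_lt_of_le (by linarith) (le_norm_vline c v)).ne'
  · have h1 : 1 + ‖v‖ ^ 2 ≤ ‖vline c v‖ ^ 2 := by
      rw [← Complex.normSq_eq_norm_sq, Complex.normSq_apply, vline_re, vline_im, Real.norm_eq_abs,
        sq_abs]
      nlinarith
    rw [Real.norm_of_nonneg (by positivity), neg_neg,
      show ‖vline c v‖ ^ a = (‖vline c v‖ ^ 2) ^ (a / 2) by
        rw [← Real.rpow_natCast, ← Real.rpow_mul (norm_nonneg _)]; congr 1; push_cast; ring]
    exact Real.rpow_le_rpow_of_nonpos (by positivity) h1 (by linarith)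

lemma continuous_stableExpDeriv₂_vline (α : ℝ) (hα0 : 0 < α) (y : ℝ) {c : ℝ} (hc : 0 < c) :
    Continuous fun v => stableExpDeriv₂ α y (vline c v) := by
  have h1 := continuous_stableExp_vline hα0 y hc.le
  have h2 := continuous_vline_cpow hc ((α - 2 : ℝ) : ℂ)
  have h3 := continuous_vline_cpow hc ((α - 1 : ℝ) : ℂ)
  unfold stableExpDeriv₂
  fun_prop

/-- With w = y|u|^α both terms of the prefactor are at most multiples of y|u|^(α-2) times 1 and w.
Split e^(-κw) into two equal halves: one absorbs 1 + w, and the other, since |u| ≥ c, gives decay in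
y uniformly along the line. -/
lemma norm_stableExpDeriv₂_le {α y c : ℝ} (hα0 : 0 < α) (hα1 : α < 1) (hy : 0 ≤ y) (hc : 0 < c)
    (v : ℝ) :
    ‖stableExpDeriv₂ α y (vline c v)‖ ≤
      (1 + 2 / Real.cos (α * (Real.pi / 2))) * (y * Real.exp
        (-(Real.cos (α * (Real.pi / 2)) * c ^ α / 2 * y))) * ‖vline c v‖ ^ (α - 2) := by
  have hk := cos_mul_pi_div_two_pos hα0 hα1
  set κ := Real.cos (α * (Real.pi / 2))
  set u := vline c v with hu
  have hr : 0 < ‖u‖ := hc.trans_le (le_norm_vline c v)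
  have hexp := norm_stableExp_le hα0 hα1 hy (u := u) (by simp [hu, hc.le])
  change ‖stableExp α y u‖ ≤ Real.exp (-(y * κ * ‖u‖ ^ α)) at hexp
  set w := y * ‖u‖ ^ α with hw
  have hw0 : 0 ≤ w := by positivity
  have hpow : (‖u‖ ^ (α - 1)) ^ 2 = ‖u‖ ^ (α - 2) * ‖u‖ ^ α := by
    rw [← Real.rpow_natCast, ← Real.rpow_mul hr.le, ← Real.rpow_add hr]
    congr 1; push_cast; ring
  have h1 : ‖y * (α * (1 - α)) * u ^ ((α - 2 : ℝ) : ℂ) +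
      (y * α * u ^ ((α - 1 : ℝ) : ℂ)) ^ 2‖ ≤ y * ‖u‖ ^ (α - 2) * (1 + w) := by
    refine (norm_add_le _ _).trans ?_
    have e1 : ‖(y : ℂ) * (α * (1 - α)) * u ^ ((α - 2 : ℝ) : ℂ)‖ =
        y * ‖u‖ ^ (α - 2) * (α * (1 - α)) := by
      rw [norm_mul, norm_mul, Complex.norm_cpow_real,
        show (α * (1 - α) : ℂ) = ((α * (1 - α) : ℝ) : ℂ) by push_cast; rfl, Complex.norm_real,
        Complex.norm_real, Real.norm_of_nonneg hy,
        Real.norm_of_nonneg (mul_nonneg hα0.le (by linarith))]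
      ring
    have e2 : ‖((y : ℂ) * α * u ^ ((α - 1 : ℝ) : ℂ)) ^ 2‖ =
        y * ‖u‖ ^ (α - 2) * (α ^ 2 * w) := by
      rw [norm_pow, norm_mul, norm_mul, Complex.norm_cpow_real, Complex.norm_real,
        Complex.norm_real, Real.norm_of_nonneg hy, Real.norm_of_nonneg hα0.le, mul_pow, hpow, hw]
      ring
    rw [e1, e2, ← mul_add]
    gcongr
    · nlinarith
    · exact mul_le_of_le_one_left hw0 (by nlinarith)
  have h2 : (1 + w) * Real.exp (-(y * κ * ‖u‖ ^ α)) ≤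
      (1 + 2 / κ) * Real.exp (-(κ * c ^ α / 2 * y)) := by
    have e1 : Real.exp (-(y * κ * ‖u‖ ^ α)) = Real.exp (-(κ * w / 2)) * Real.exp (-(κ * w / 2)) := by
      rw [← Real.exp_add, hw]; congr 1; ring
    have e2 : Real.exp (-(κ * w / 2)) ≤ Real.exp (-(κ * c ^ α / 2 * y)) := by
      have : c ^ α ≤ ‖u‖ ^ α := Real.rpow_le_rpow hc.le (le_norm_vline c v) hα0.le
      have : κ * (y * c ^ α) ≤ κ * w := by rw [hw]; gcongr
      exact Real.exp_le_exp.2 (by linarith)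
    have e3 : (1 + w) * Real.exp (-(κ * w / 2)) ≤ 1 + 2 / κ := by
      rw [Real.exp_neg, ← div_eq_mul_inv, div_le_iff₀ (Real.exp_pos _)]
      have h3 := Real.add_one_le_exp (κ * w / 2)
      have h4 : 0 ≤ κ * w / 2 := by positivity
      have h5 : w = 2 / κ * (κ * w / 2) := by field_simp
      have h6 : 0 < 2 / κ := by positivity
      calc 1 + w = 1 * 1 + 2 / κ * (κ * w / 2) := by rw [← h5]; ring
        _ ≤ 1 * Real.exp (κ * w / 2) + 2 / κ * Real.exp (κ * w / 2) := by
          gcongr <;> linarith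
        _ = _ := by ring
    rw [e1, ← mul_assoc]
    gcongr
  rw [stableExpDeriv₂, norm_mul]
  calc _ ≤ y * ‖u‖ ^ (α - 2) * (1 + w) * Real.exp (-(y * κ * ‖u‖ ^ α)) := by gcongr
    _ = y * ‖u‖ ^ (α - 2) * ((1 + w) * Real.exp (-(y * κ * ‖u‖ ^ α))) := by ring
    _ ≤ y * ‖u‖ ^ (α - 2) * ((1 + 2 / κ) * Real.exp (-(κ * c ^ α / 2 * y))) := by gcongr
    _ = _ := by ring

lemma integrable_stableExpDeriv₂_vline {α y c : ℝ} (hα0 : 0 < α) (hα1 : α < 1) (hy : 0 ≤ y)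
    (hc : 1 ≤ c) : Integrable fun v => stableExpDeriv₂ α y (vline c v) :=
  ((integrable_norm_vline_rpow hc (by linarith : α - 2 < -1)).const_mul _).mono'
    (continuous_stableExpDeriv₂_vline α hα0 y (by linarith)).aestronglyMeasurable
    (ae_of_all _ fun v => norm_stableExpDeriv₂_le hα0 hα1 hy (by linarith) v)

/-- The absolutely convergent form of the stable density obtained by integrating by parts twice. -/
lemma sq_mul_stableDensity {α x y c : ℝ} (hα0 : 0 < α) (hα1 : α < 1) (hx : 0 < x)
    (hy : 0 < y) (hc : 1 ≤ c) :
    x ^ 2 * stableDensity α x y = (2 * Real.pi)⁻¹ *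
      (∫ v, Complex.exp (vline c v * x) * stableExpDeriv₂ α y (vline c v)).re := by
  have hc0 : 0 < c := by linarith
  have hi := integrable_stableExp_vline hα0 hα1 hy hc0.le
  have hi' : Integrable fun v =>
      -(y * α * vline c v ^ ((α - 1 : ℝ) : ℂ)) * stableExp α y (vline c v) :=
    ((integrable_vline_cpow_mul hc0 (by linarith : α - 1 ≤ 0) hi).const_mul (-(y * α : ℂ))).congr
      (ae_of_all _ fun v => by simp only; ring)
  have h1 := mul_integral_exp_vline_mul (x := x)
    (Q' := fun u => -(y * α * u ^ ((α - 1 : ℝ) : ℂ)) * stableExp α y u)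
    (fun v => hasDerivAt_stableExp' α y (u := vline c v) (by simpa using hc0)) hi hi'
  have h2 := mul_integral_exp_vline_mul (x := x)
    (fun v => hasDerivAt_deriv_stableExp α y (u := vline c v) (by simpa using hc0)) hi'
    (integrable_stableExpDeriv₂_vline hα0 hα1 hy.le hc)
  have h3 : ((x ^ 2 : ℝ) : ℂ) * ∫ v, Complex.exp (vline c v * x) * stableExp α y (vline c v) =
      ∫ v, Complex.exp (vline c v * x) * stableExpDeriv₂ α y (vline c v) := by
    push_cast
    rw [sq, mul_assoc, h1, mul_neg, h2, neg_neg]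
  rw [← h3, Complex.re_ofReal_mul, stableDensity_eq_bromwich hα0 hα1 hx hy hc0.le]
  ring

/-- For fixed `x` the stable density vanishes linearly at `y = 0` and decays faster than any
exponential. -/
lemma exists_abs_stableDensity_le {α x : ℝ} (hα0 : 0 < α) (hα1 : α < 1) (hx : 0 < x) (k : ℝ) :
    ∃ C : ℝ, 0 ≤ C ∧ ∀ y, 0 < y → |stableDensity α x y| ≤ C * (y * Real.exp (-(k * y))) := by
  have hk := cos_mul_pi_div_two_pos hα0 hα1
  set κ := Real.cos (α * (Real.pi / 2))
  -- The decay rate κc^α/2 exceeds any prescribed k once the line is far enough to the right.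
  obtain ⟨c, hc1, hck⟩ : ∃ c : ℝ, 1 ≤ c ∧ k ≤ κ * c ^ α / 2 := by
    have h : Tendsto (fun c : ℝ => κ * c ^ α / 2) atTop atTop :=
      ((tendsto_rpow_atTop hα0).const_mul_atTop hk).atTop_div_const two_pos
    exact ((eventually_ge_atTop 1).and (h.eventually_ge_atTop k)).exists
  set J := ∫ v, ‖vline c v‖ ^ (α - 2)
  have hJ : 0 ≤ J := integral_nonneg fun v => by positivity
  refine ⟨(x ^ 2)⁻¹ * ((2 * Real.pi)⁻¹ * (Real.exp (c * x) * ((1 + 2 / κ) * J))),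
    by positivity, fun y hy => ?_⟩
  have h1 : |(∫ v, Complex.exp (vline c v * x) * stableExpDeriv₂ α y (vline c v)).re| ≤
      Real.exp (c * x) * ((1 + 2 / κ) * (y * Real.exp (-(κ * c ^ α / 2 * y))) * J) := by
    refine (Complex.abs_re_le_norm _).trans ?_
    rw [← integral_const_mul, ← integral_const_mul]
    refine norm_integral_le_of_norm_le
      (((integrable_norm_vline_rpow hc1 (by linarith)).const_mul _).const_mul _)
      (ae_of_all _ fun v => ?_)
    rw [norm_mul, norm_exp_vline_mul]
    gcongr
    exact norm_stableExpDeriv₂_le hα0 hα1 hy.le (by linarith) v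
  have h2 : stableDensity α x y = (x ^ 2)⁻¹ * (x ^ 2 * stableDensity α x y) := by
    field_simp
  rw [h2, sq_mul_stableDensity hα0 hα1 hx hy hc1, abs_mul, abs_mul,
    abs_of_nonneg (by positivity : (0 : ℝ) ≤ (x ^ 2)⁻¹),
    abs_of_nonneg (by positivity : (0 : ℝ) ≤ (2 * Real.pi)⁻¹)]
  calc _ ≤ (x ^ 2)⁻¹ * ((2 * Real.pi)⁻¹ * (Real.exp (c * x) *
        ((1 + 2 / κ) * (y * Real.exp (-(κ * c ^ α / 2 * y))) * J))) := by gcongr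
    _ ≤ (x ^ 2)⁻¹ * ((2 * Real.pi)⁻¹ * (Real.exp (c * x) *
        ((1 + 2 / κ) * (y * Real.exp (-(k * y))) * J))) := by gcongr
    _ = _ := by ring

/-! ### Euler's integral with complex rate and the inverse Laplace transform of powers. -/

lemma integrableOn_rpow_mul_exp_neg_mul {s b : ℝ} (hs : -1 < s) (hb : 0 < b) :
    IntegrableOn (fun y : ℝ => y ^ s * Real.exp (-(b * y))) (Ioi 0) := by
  simpa using integrableOn_rpow_mul_exp_neg_mul_rpow hs one_pos hb

lemma norm_rpow_mul_cexp {s y : ℝ} (hy : 0 < y) (z : ℂ) :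
    ‖((y ^ s : ℝ) : ℂ) * Complex.exp (-(z * y))‖ = y ^ s * Real.exp (-(z.re * y)) := by
  rw [norm_mul, Complex.norm_real, Real.norm_of_nonneg (by positivity), Complex.norm_exp,
    Complex.neg_re, Complex.re_mul_ofReal]

lemma measurable_rpow_mul_cexp (s : ℝ) (z : ℂ) :
    Measurable fun y : ℝ => ((y ^ s : ℝ) : ℂ) * Complex.exp (-(z * y)) := by
  fun_prop

lemma integrableOn_rpow_mul_cexp {s : ℝ} (hs : -1 < s) {z : ℂ} (hz : 0 < z.re) :
    IntegrableOn (fun y : ℝ => ((y ^ s : ℝ) : ℂ) * Complex.exp (-(z * y))) (Ioi 0) :=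
  (integrableOn_rpow_mul_exp_neg_mul hs hz).mono'
    (measurable_rpow_mul_cexp s z).aestronglyMeasurable
    ((ae_restrict_mem measurableSet_Ioi).mono fun _ hy => (norm_rpow_mul_cexp hy z).le)

lemma differentiableAt_integral_rpow_mul_cexp {s : ℝ} (hs : -1 < s) {z : ℂ} (hz : 0 < z.re) :
    DifferentiableAt ℂ
      (fun z : ℂ => ∫ y in Ioi (0 : ℝ), ((y ^ s : ℝ) : ℂ) * Complex.exp (-(z * y))) z := by
  have h := hasDerivAt_integral_of_dominated_loc_of_deriv_le
    (μ := volume.restrict (Ioi (0 : ℝ))) (x₀ := z) (s := {w : ℂ | z.re / 2 < w.re})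
    (F := fun w (y : ℝ) => ((y ^ s : ℝ) : ℂ) * Complex.exp (-(w * y)))
    (F' := fun w (y : ℝ) => ((y ^ s : ℝ) : ℂ) * (Complex.exp (-(w * y)) * -(1 * y)))
    (bound := fun y => y ^ (s + 1) * Real.exp (-(z.re / 2 * y)))
    ((isOpen_lt continuous_const Complex.continuous_re).mem_nhds
      (show z.re / 2 < z.re by linarith))
    (Eventually.of_forall fun w => (measurable_rpow_mul_cexp s w).aestronglyMeasurable)
    (integrableOn_rpow_mul_cexp hs hz)
    (by
      have : Measurable fun y : ℝ => ((y ^ s : ℝ) : ℂ) * (Complex.exp (-(z * y)) * -(1 * y)) := by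
        fun_prop
      exact this.aestronglyMeasurable)
    ?_ (integrableOn_rpow_mul_exp_neg_mul (by linarith) (by linarith))
    (ae_of_all _ fun y w _ =>
      ((((hasDerivAt_id w).mul_const (y : ℂ)).neg).cexp).const_mul _)
  · exact h.2.differentiableAt
  · filter_upwards [ae_restrict_mem measurableSet_Ioi] with y hy w hw
    have hy0 : 0 < y := hy
    have hw' : z.re / 2 < w.re := hw
    rw [← mul_assoc, norm_mul, norm_rpow_mul_cexp hy0, norm_neg, one_mul, Complex.norm_real,
      Real.norm_of_nonneg hy0.le, Real.rpow_add hy0, Real.rpow_one, mul_right_comm]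
    gcongr

/-- Euler's integral with a complex rate in the right half-plane. -/
lemma integral_rpow_mul_cexp {a : ℝ} (ha : 0 < a) {z : ℂ} (hz : 0 < z.re) :
    ∫ y in Ioi (0 : ℝ), ((y ^ (a - 1) : ℝ) : ℂ) * Complex.exp (-(z * y)) =
      Real.Gamma a * z ^ ((-a : ℝ) : ℂ) := by
  have hopen : IsOpen {w : ℂ | 0 < w.re} := isOpen_lt continuous_const Complex.continuous_re
  have h1 : AnalyticOnNhd ℂ (fun z : ℂ => ∫ y in Ioi (0 : ℝ),
      ((y ^ (a - 1) : ℝ) : ℂ) * Complex.exp (-(z * y))) {w : ℂ | 0 < w.re} :=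
    DifferentiableOn.analyticOnNhd (fun w hw =>
      (differentiableAt_integral_rpow_mul_cexp (by linarith) hw).differentiableWithinAt) hopen
  have h2 : AnalyticOnNhd ℂ (fun z : ℂ => Real.Gamma a * z ^ ((-a : ℝ) : ℂ)) {w : ℂ | 0 < w.re} :=
    DifferentiableOn.analyticOnNhd (fun w hw => (((hasDerivAt_id w).cpow_const
      (Or.inl hw)).const_mul _).differentiableAt.differentiableWithinAt) hopen
  have hreal : ∀ r : ℝ, 0 < r → ∫ y in Ioi (0 : ℝ), ((y ^ (a - 1) : ℝ) : ℂ) *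
      Complex.exp (-((r : ℂ) * y)) = Real.Gamma a * (r : ℂ) ^ ((-a : ℝ) : ℂ) := fun r hr => by
    have h := Real.integral_rpow_mul_exp_neg_mul_Ioi ha hr
    have e : ∀ y : ℝ, ((y ^ (a - 1) : ℝ) : ℂ) * Complex.exp (-((r : ℂ) * y)) =
        ((y ^ (a - 1) * Real.exp (-(r * y)) : ℝ) : ℂ) := fun y => by push_cast; rfl
    simp_rw [e]
    rw [integral_complex_ofReal, h, ← Complex.ofReal_cpow hr.le, Real.rpow_neg hr.le, one_div,
      Real.inv_rpow hr.le]
    push_cast; ring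
  -- Identity theorem: both sides are analytic and agree on the positive reals, in particular at the
  -- points 1 + 1/(n+1), which accumulate at 1.
  refine h1.eqOn_of_preconnected_of_frequently_eq h2
    (convex_halfSpace_re_gt 0).isPreconnected (z₀ := 1) (by simp) ?_ hz
  have ht : Tendsto (fun n : ℕ => ((1 + 1 / ((n : ℝ) + 1) : ℝ) : ℂ)) atTop (𝓝[≠] 1) := by
    refine tendsto_nhdsWithin_iff.2 ⟨?_, Eventually.of_forall fun n => ?_⟩
    · have := (tendsto_one_div_add_atTop_nhds_zero_nat (𝕜 := ℝ)).const_add 1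
      have := (Complex.continuous_ofReal.tendsto _).comp this
      simpa [Function.comp_def] using this
    · have : (0 : ℝ) < 1 / ((n : ℝ) + 1) := by positivity
      simp only [mem_compl_iff, mem_singleton_iff]
      intro h
      have h' : 1 + 1 / ((n : ℝ) + 1) = 1 := by exact_mod_cast h
      linarith
  exact ht.frequently (Frequently.of_forall fun n => hreal _ (by positivity))

/-- Inverse Laplace transform of a power, along the line `Re u = c`. -/
lemma integral_exp_vline_mul_cpow {a c x : ℝ} (ha : 1 < a) (hc : 1 ≤ c) (hx : 0 < x) :
    ∫ v, Complex.exp (vline c v * x) * vline c v ^ ((-a : ℝ) : ℂ) =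
      (2 * Real.pi * (x ^ (a - 1) / Real.Gamma a) : ℝ) := by
  have hc0 : 0 < c := by linarith
  have hG : 0 < Real.Gamma a := Real.Gamma_pos_of_pos (by linarith)
  -- Since a > 1, the extension by zero through `max y 0` is continuous on all of ℝ, so Fourier
  -- inversion holds at every point.
  set f : ℝ → ℂ := fun y => ((max y 0 ^ (a - 1) * Real.exp (-(c * y)) : ℝ) : ℂ) with hf
  have hfc : Continuous f := by
    have : Continuous fun y : ℝ => max y 0 ^ (a - 1) :=
      (continuous_id.max continuous_const).rpow_const fun y => Or.inr (by linarith)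
    fun_prop
  have hf0 : ∀ y, y ≤ 0 → f y = 0 := fun y hy => by
    simp [hf, max_eq_right hy, Real.zero_rpow (by linarith : a - 1 ≠ 0)]
  have hfi : IntegrableOn f (Ioi 0) := by
    have h : IntegrableOn (fun y : ℝ => ((y ^ (a - 1) * Real.exp (-(c * y)) : ℝ) : ℂ)) (Ioi 0) :=
      (integrableOn_rpow_mul_exp_neg_mul (by linarith) hc0).ofReal
    refine h.congr_fun (fun y hy => ?_) measurableSet_Ioi
    simp [hf, max_eq_left (le_of_lt (show 0 < y from hy))]
  have hsupp : Function.support f ⊆ Ioi 0 := fun y hy => by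
    by_contra h
    exact hy (hf0 y (not_lt.1 h))
  have hfint : Integrable f := (integrableOn_iff_integrable_of_support_subset hsupp).1 hfi
  have hfour : ∀ w : ℝ, FourierTransform.fourier f w =
      Real.Gamma a * vline c (2 * Real.pi * w) ^ ((-a : ℝ) : ℂ) := fun w => by
    rw [← integral_rpow_mul_cexp (by linarith) (by simpa using hc0), Real.fourier_eq',
      ← setIntegral_eq_integral_of_forall_compl_eq_zero (s := Ioi 0)]
    · refine setIntegral_congr_fun measurableSet_Ioi fun y hy => ?_
      simp only [hf, max_eq_left (le_of_lt (show 0 < y from hy)), smul_eq_mul, vline]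
      push_cast
      rw [mul_left_comm, ← Complex.exp_add]
      congr 2
      simp
      ring
    · intro y hy
      rw [hf0 y (not_lt.1 hy), smul_zero]
  have hpow : Integrable fun v => vline c v ^ ((-a : ℝ) : ℂ) :=
    (integrable_norm_vline_rpow hc (by linarith : -a < -1)).mono'
      (continuous_vline_cpow hc0 _).aestronglyMeasurable
      (ae_of_all _ fun v => (Complex.norm_cpow_real _ _).le)
  have hFi : Integrable (FourierTransform.fourier f) := by
    refine (((hpow.comp_mul_left' (by positivity : 2 * Real.pi ≠ 0))).const_mul
      (Real.Gamma a : ℂ)).congr (ae_of_all _ fun w => (hfour w).symm)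
  have hinv := congrFun (hfc.fourierInv_fourier_eq hfint hFi) x
  rw [Real.fourierInv_eq'] at hinv
  simp_rw [hfour] at hinv
  have hsub := Measure.integral_comp_mul_left
    (fun v : ℝ => Complex.exp (v * x * Complex.I) * (Real.Gamma a * vline c v ^ ((-a : ℝ) : ℂ)))
    (2 * Real.pi)
  have e1 : ∫ w : ℝ, Complex.exp ((2 * Real.pi * w : ℝ) * x * Complex.I) *
      (Real.Gamma a * vline c (2 * Real.pi * w) ^ ((-a : ℝ) : ℂ)) = f x := by
    rw [← hinv]
    congr 1 with w
    rw [smul_eq_mul]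
    congr 2
    simp
    ring
  rw [e1] at hsub
  have e2 : ∫ v : ℝ, Complex.exp (vline c v * x) * vline c v ^ ((-a : ℝ) : ℂ) =
      Complex.exp (c * x) * (Real.Gamma a : ℂ)⁻¹ * ∫ v : ℝ, Complex.exp (v * x * Complex.I) *
        (Real.Gamma a * vline c v ^ ((-a : ℝ) : ℂ)) := by
    rw [← integral_const_mul]
    congr 1 with v
    have : Complex.exp (vline c v * x) =
        Complex.exp (c * x) * Complex.exp (v * x * Complex.I) := by
      rw [← Complex.exp_add, vline]; congr 1; ring
    have hG' : (Real.Gamma a : ℂ) ≠ 0 := by exact_mod_cast hG.ne'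
    rw [this]
    field_simp
  have e3 : ∫ v : ℝ, Complex.exp (v * x * Complex.I) *
        (Real.Gamma a * vline c v ^ ((-a : ℝ) : ℂ)) = (2 * Real.pi : ℝ) * f x := by
    rw [hsub, abs_of_pos (by positivity), Complex.real_smul, ← mul_assoc, ← Complex.ofReal_mul,
      mul_inv_cancel₀ (by positivity), Complex.ofReal_one, one_mul]
  rw [e2, e3, hf]
  simp only [max_eq_left hx.le]
  rw [show Complex.exp (c * x) = (Real.exp (c * x) : ℂ) by push_cast; rfl]
  norm_cast
  rw [Real.exp_neg]
  have := (Real.exp_pos (c * x)).ne'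
  field_simp

/-! ### Mellin transform of the stable density in y, and the series for the mixture. -/

lemma measurable_stableDensity (α x : ℝ) : Measurable (stableDensity α x) := by
  have h : StronglyMeasurable (Function.uncurry fun y θ : ℝ =>
      Complex.exp (-(Complex.I * θ * x)) *
        Complex.exp (-((y : ℂ) * (-(Complex.I * θ)) ^ (α : ℂ)))) := by
    refine Measurable.stronglyMeasurable ?_
    unfold Function.uncurry
    fun_prop
  exact (Complex.measurable_re.comp h.integral_prod_right.measurable).const_mul _

/-- The argument of u^α is α arg u, of modulus at most π/2, so the principal logarithm does not
wrap. -/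
lemma cpow_cpow_of_re_pos {α : ℝ} (hα0 : 0 < α) (hα1 : α < 1) {u : ℂ} (hu : 0 < u.re) (b : ℝ) :
    (u ^ (α : ℂ)) ^ (b : ℂ) = u ^ ((α * b : ℝ) : ℂ) := by
  have harg := Complex.abs_arg_le_pi_div_two_iff.2 hu.le
  have h : |u.arg * α| ≤ Real.pi / 2 := by
    rw [abs_mul, abs_of_pos hα0]
    exact (mul_le_of_le_one_right (abs_nonneg _) hα1.le).trans harg
  have h' := abs_le.1 h
  have hpi := Real.pi_pos
  push_cast
  rw [Complex.cpow_mul] <;> rw [Complex.im_mul_ofReal, Complex.log_im] <;> linarith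

lemma cpow_re_pos {α : ℝ} (hα0 : 0 < α) (hα1 : α < 1) {u : ℂ} (hu : 0 < u.re) :
    0 < (u ^ (α : ℂ)).re := by
  have hn : 0 < ‖u‖ := hu.trans_le (Complex.re_le_norm u)
  have := cos_mul_pi_div_two_pos hα0 hα1
  exact lt_of_lt_of_le (by positivity) (norm_rpow_mul_cos_le_re_cpow hα0 hα1 hu.le)

/-- Mellin transform in `y` of the second derivative of `exp (-y u ^ α)`. -/
lemma integral_rpow_mul_stableExpDeriv₂ {α s : ℝ} (hα0 : 0 < α) (hα1 : α < 1) (hs : 0 < s) {u : ℂ}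
    (hu : 0 < u.re) :
    ∫ y in Ioi (0 : ℝ), ((y ^ (s - 1) : ℝ) : ℂ) * stableExpDeriv₂ α y u =
      (Real.Gamma s * (α * s) * (α * s + 1) : ℝ) * u ^ ((-(α * s + 2) : ℝ) : ℂ) := by
  have hre := cpow_re_pos hα0 hα1 hu
  have hu0 : u ≠ 0 := by rintro rfl; simp at hu
  have e : ∀ y ∈ Ioi (0 : ℝ), ((y ^ (s - 1) : ℝ) : ℂ) * stableExpDeriv₂ α y u =
      (α * (1 - α)) * u ^ ((α - 2 : ℝ) : ℂ) *
        (((y ^ (s + 1 - 1) : ℝ) : ℂ) * Complex.exp (-(u ^ (α : ℂ) * y))) +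
      (α * u ^ ((α - 1 : ℝ) : ℂ)) ^ 2 *
        (((y ^ (s + 2 - 1) : ℝ) : ℂ) * Complex.exp (-(u ^ (α : ℂ) * y))) := fun y hy => by
    have hy0 : (0 : ℝ) < y := hy
    have h1 : y ^ (s + 1 - 1) = y ^ (s - 1) * y := by
      rw [show s + 1 - 1 = s - 1 + 1 by ring, Real.rpow_add hy0, Real.rpow_one]
    have h2 : y ^ (s + 2 - 1) = y ^ (s - 1) * y ^ 2 := by
      rw [show s + 2 - 1 = s - 1 + (2 : ℕ) by push_cast; ring, Real.rpow_add hy0,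
        Real.rpow_natCast]
    rw [h1, h2, stableExpDeriv₂, stableExp, mul_comm (u ^ (α : ℂ))]
    push_cast
    ring
  rw [setIntegral_congr_fun measurableSet_Ioi e, integral_add
    ((integrableOn_rpow_mul_cexp (by linarith) hre).const_mul _)
    ((integrableOn_rpow_mul_cexp (by linarith) hre).const_mul _), integral_const_mul,
    integral_const_mul, integral_rpow_mul_cexp (by linarith) hre,
    integral_rpow_mul_cexp (by linarith) hre, cpow_cpow_of_re_pos hα0 hα1 hu,
    cpow_cpow_of_re_pos hα0 hα1 hu]
  have g1 : Real.Gamma (s + 1) = s * Real.Gamma s := Real.Gamma_add_one hs.ne'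
  have g2 : Real.Gamma (s + 2) = (s + 1) * (s * Real.Gamma s) := by
    rw [← g1, ← Real.Gamma_add_one (by linarith)]; congr 1; ring
  have p1 : u ^ ((α - 2 : ℝ) : ℂ) * u ^ ((α * -(s + 1) : ℝ) : ℂ) =
      u ^ ((-(α * s + 2) : ℝ) : ℂ) := by
    rw [← Complex.cpow_add _ _ hu0, ← Complex.ofReal_add]; congr 2; ring
  have p2 : (u ^ ((α - 1 : ℝ) : ℂ)) ^ 2 * u ^ ((α * -(s + 2) : ℝ) : ℂ) =
      u ^ ((-(α * s + 2) : ℝ) : ℂ) := by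
    rw [sq, ← Complex.cpow_add _ _ hu0, ← Complex.cpow_add _ _ hu0, ← Complex.ofReal_add,
      ← Complex.ofReal_add]
    congr 2; ring
  rw [g1, g2]
  -- Both terms carry the same power of u, and (1-α)αs + α²s(s+1) = αs(αs+1).
  calc _ = (α * (1 - α) * (s * Real.Gamma s)) *
        (u ^ ((α - 2 : ℝ) : ℂ) * u ^ ((α * -(s + 1) : ℝ) : ℂ)) +
        (α ^ 2 * ((s + 1) * (s * Real.Gamma s))) *
        ((u ^ ((α - 1 : ℝ) : ℂ)) ^ 2 * u ^ ((α * -(s + 2) : ℝ) : ℂ)) := by push_cast; ring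
    _ = _ := by rw [p1, p2]; push_cast; ring

/-- Mellin transform of the stable density in its time variable. -/
lemma integral_rpow_mul_stableDensity {α x s : ℝ} (hα0 : 0 < α) (hα1 : α < 1) (hx : 0 < x)
    (hs : 0 < s) :
    ∫ y in Ioi (0 : ℝ), y ^ (s - 1) * stableDensity α x y =
      Real.Gamma s * (x ^ (α * s - 1) / Real.Gamma (α * s)) := by
  have hk := cos_mul_pi_div_two_pos hα0 hα1
  have hb : 0 < Real.cos (α * (Real.pi / 2)) * (1 : ℝ) ^ α / 2 := by simpa using hk
  set F : ℝ → ℝ → ℂ := fun y v => ((y ^ (s - 1) : ℝ) : ℂ) *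
    (Complex.exp (vline 1 v * x) * stableExpDeriv₂ α y (vline 1 v)) with hF
  have hFi : Integrable (Function.uncurry F) ((volume.restrict (Ioi (0 : ℝ))).prod volume) := by
    have hbound := Integrable.mul_prod
      ((integrableOn_rpow_mul_exp_neg_mul (by linarith : -1 < s) hb).const_mul
        (Real.exp (1 * x) * (1 + 2 / Real.cos (α * (Real.pi / 2)))))
      (integrable_norm_vline_rpow le_rfl (by linarith : α - 2 < -1))
    refine hbound.mono' ?_ ?_
    · refine Measurable.aestronglyMeasurable ?_
      simp only [hF, stableExpDeriv₂, stableExp, vline]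
      fun_prop
    · filter_upwards [Measure.quasiMeasurePreserving_fst.ae (ae_restrict_mem measurableSet_Ioi)]
        with p hp
      have hp0 : 0 < p.1 := hp
      have h := norm_stableExpDeriv₂_le hα0 hα1 hp0.le one_pos p.2
      have e : p.1 ^ s = p.1 ^ (s - 1) * p.1 := by
        rw [← Real.rpow_add_one hp0.ne']; congr 1; ring
      simp only [hF, Function.uncurry]
      rw [norm_mul, norm_mul, norm_exp_vline_mul, Complex.norm_real,
        Real.norm_of_nonneg (by positivity), e]
      calc _ ≤ _ := mul_le_mul_of_nonneg_left
            (mul_le_mul_of_nonneg_left h (Real.exp_pos _).le) (by positivity)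
        _ = _ := by ring
  have hy : ∀ y ∈ Ioi (0 : ℝ), x ^ 2 * (y ^ (s - 1) * stableDensity α x y) =
      (2 * Real.pi)⁻¹ * (∫ v, F y v).re := fun y hy => by
    rw [hF]
    simp only
    rw [integral_const_mul, Complex.re_ofReal_mul, mul_left_comm,
      sq_mul_stableDensity hα0 hα1 hx hy le_rfl]
    ring
  have h1 : x ^ 2 * ∫ y in Ioi (0 : ℝ), y ^ (s - 1) * stableDensity α x y =
      (2 * Real.pi)⁻¹ * (∫ v, ∫ y in Ioi (0 : ℝ), F y v).re := by
    rw [← integral_const_mul, setIntegral_congr_fun measurableSet_Ioi hy, integral_const_mul,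
      ← integral_integral_swap hFi]
    congr 1
    exact Complex.reCLM.integral_comp_comm hFi.integral_prod_left
  have h2 : ∫ v, ∫ y in Ioi (0 : ℝ), F y v = (Real.Gamma s * (α * s) * (α * s + 1) *
      (2 * Real.pi * (x ^ (α * s + 2 - 1) / Real.Gamma (α * s + 2))) : ℝ) := by
    rw [Complex.ofReal_mul, ← integral_exp_vline_mul_cpow (by nlinarith) le_rfl hx,
      ← integral_const_mul]
    congr 1 with v
    have e : ∀ y : ℝ, F y v = Complex.exp (vline 1 v * x) *
      (((y ^ (s - 1) : ℝ) : ℂ) * stableExpDeriv₂ α y (vline 1 v)) := fun y => by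
        rw [hF]; ring
    simp_rw [e]
    rw [integral_const_mul, integral_rpow_mul_stableExpDeriv₂ hα0 hα1 hs (by simp)]
    ring
  rw [h2, Complex.ofReal_re] at h1
  have hαs : 0 < α * s := by positivity
  -- The factor αs(αs+1) and the x² introduced by the integrations by parts both cancel against this
  -- shift by 2.
  have g2 : Real.Gamma (α * s + 2) = (α * s + 1) * (α * s * Real.Gamma (α * s)) := by
    rw [← Real.Gamma_add_one hαs.ne', ← Real.Gamma_add_one (by linarith)]; congr 1; ring
  have hp : x ^ (α * s + 2 - 1) = x ^ 2 * x ^ (α * s - 1) := by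
    rw [show α * s + 2 - 1 = (2 : ℕ) + (α * s - 1) by push_cast; ring, Real.rpow_add hx,
      Real.rpow_natCast]
  have hG := Real.Gamma_pos_of_pos hαs
  rw [g2, hp] at h1
  have hx2 : x ^ 2 ≠ 0 := by positivity
  apply mul_left_cancel₀ hx2
  rw [h1]
  have := Real.pi_pos
  have : α * s + 1 ≠ 0 := by linarith
  field_simp

/-- Power series in `μ` of the Laplace-Mellin transform of the stable density. -/
lemma hasSum_integral_exp_mul_stableDensity {α x s μ : ℝ} (hα0 : 0 < α) (hα1 : α < 1) (hx : 0 < x)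
    (hs : 0 < s) (hμ : 0 < μ) :
    HasSum (fun k : ℕ => (-μ) ^ k / k.factorial *
        (Real.Gamma (s + k) * (x ^ (α * (s + k) - 1) / Real.Gamma (α * (s + k)))))
      (∫ y in Ioi (0 : ℝ), y ^ (s - 1) * (Real.exp (-(μ * y)) * stableDensity α x y)) := by
  -- The absolute exponential series sums to e^(μy); the rate 1 + μ leaves the integrable majorant C
  -- y^s e^(-y).
  obtain ⟨C, hC, hbd⟩ := exists_abs_stableDensity_le hα0 hα1 hx (1 + μ)
  have hm := measurable_stableDensity α x
  have hexp : ∀ z : ℝ, HasSum (fun k : ℕ => z ^ k / k.factorial) (Real.exp z) := fun z => by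
    rw [Real.exp_eq_exp_ℝ]; exact NormedSpace.expSeries_div_hasSum_exp z
  have key := hasSum_integral_of_dominated_convergence (μ := volume.restrict (Ioi (0 : ℝ)))
    (F := fun (k : ℕ) y => (-(μ * y)) ^ k / k.factorial * (y ^ (s - 1) * stableDensity α x y))
    (f := fun y => y ^ (s - 1) * (Real.exp (-(μ * y)) * stableDensity α x y))
    (fun k y => (μ * y) ^ k / k.factorial * (C * (y ^ s * Real.exp (-((1 + μ) * y)))))
    (fun k => by fun_prop) (fun k => ?_)
    (ae_of_all _ fun y => (hexp (μ * y)).summable.mul_right _) ?_ ?_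
  · refine (congrArg (fun f : ℕ → ℝ => HasSum f _) (funext fun k => ?_)).mpr key
    rw [← integral_rpow_mul_stableDensity hα0 hα1 hx (by positivity : 0 < s + k),
      ← integral_const_mul]
    refine setIntegral_congr_fun measurableSet_Ioi fun y hy => ?_
    have hy0 : (0 : ℝ) < y := hy
    rw [show s + k - 1 = s - 1 + k by ring, Real.rpow_add hy0, Real.rpow_natCast, ← neg_mul,
      mul_pow]
    ring
  · filter_upwards [ae_restrict_mem measurableSet_Ioi] with y hy
    have hy0 : 0 < y := hy
    rw [norm_mul, norm_mul, norm_div, norm_pow, norm_neg, Real.norm_of_nonneg (by positivity),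
      Real.norm_of_nonneg (by positivity), Real.norm_of_nonneg (by positivity)]
    have : y ^ s = y ^ (s - 1) * y := by
      rw [← Real.rpow_add_one hy0.ne']; congr 1; ring
    rw [this]
    calc _ ≤ (μ * y) ^ k / k.factorial * (y ^ (s - 1) *
          (C * (y * Real.exp (-((1 + μ) * y))))) := by
          gcongr
          exact hbd y hy0
      _ = _ := by ring
  · refine ((integrableOn_rpow_mul_exp_neg_mul (by linarith : -1 < s) one_pos).const_mul C).congr
      (ae_of_all _ fun y => ?_)
    simp only
    rw [((hexp (μ * y)).mul_right _).tsum_eq, show -((1 + μ) * y) = -(μ * y) + -(1 * y) by ring,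
      Real.exp_add, Real.exp_neg (μ * y)]
    have := (Real.exp_pos (μ * y)).ne'
    field_simp
  · refine ae_of_all _ fun y => ?_
    rw [mul_left_comm]
    exact (hexp (-(μ * y))).mul_right (y ^ (s - 1) * stableDensity α x y)

/-- Mixture representation of the Mittag-Leffler density. -/
lemma mlDensity_eq_integral {α ρ μ x t : ℝ} (hα0 : 0 < α) (hα1 : α < 1) (hρ : 0 < ρ) (hμ : 0 < μ)
    (hx : 0 < x) (ht : 0 < t) :
    mlDensity α ρ μ x t = μ ^ (ρ * t) / Real.Gamma (ρ * t) *
      ∫ y in Ioi (0 : ℝ), y ^ (ρ * t - 1) * (Real.exp (-(μ * y)) * stableDensity α x y) := by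
  have hs : 0 < ρ * t := mul_pos hρ ht
  rw [← ((hasSum_integral_exp_mul_stableDensity hα0 hα1 hx hs hμ).mul_left _).tsum_eq, mlDensity]
  congr 1 with k
  rw [Real.rpow_add hμ, Real.rpow_natCast, Real.Gamma_nat_eq_factorial, neg_pow μ]
  have h1 := (Real.Gamma_pos_of_pos hs).ne'
  have h2 : (k.factorial : ℝ) ≠ 0 := by positivity
  field_simp

/-! ### Holomorphy in the shape parameter, and the bracket as a derivative. -/

/-- The function whose Mellin transform is the Laplace-Mellin transform of the stable density. -/
noncomputable def dampedStable (α μ x y : ℝ) : ℂ :=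
  ((Real.exp (-(μ * y)) * stableDensity α x y : ℝ) : ℂ)

lemma measurable_dampedStable (α μ x : ℝ) : Measurable (dampedStable α μ x) := by
  have hm := measurable_stableDensity α x
  unfold dampedStable
  fun_prop

lemma exists_norm_dampedStable_le {α x : ℝ} (hα0 : 0 < α) (hα1 : α < 1) (hx : 0 < x) (μ : ℝ) :
    ∃ C : ℝ, 0 ≤ C ∧ ∀ y, 0 < y → ‖dampedStable α μ x y‖ ≤ C * (y * Real.exp (-(1 * y))) := by
  obtain ⟨C, hC, hbd⟩ := exists_abs_stableDensity_le hα0 hα1 hx (1 - μ)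
  refine ⟨C, hC, fun y hy => ?_⟩
  rw [dampedStable, Complex.norm_real, norm_mul, Real.norm_of_nonneg (Real.exp_pos _).le]
  calc _ ≤ Real.exp (-(μ * y)) * (C * (y * Real.exp (-((1 - μ) * y)))) := by
        gcongr
        exact hbd y hy
    _ = C * (y * (Real.exp (-(μ * y)) * Real.exp (-((1 - μ) * y)))) := by ring
    _ = _ := by rw [← Real.exp_add]; congr 3; ring_nf

lemma mellin_dampedStable_hasDerivAt {α x : ℝ} (hα0 : 0 < α) (hα1 : α < 1) (hx : 0 < x) (μ : ℝ)
    {s : ℂ} (hs : -1 < s.re) :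
    MellinConvergent (fun y => Real.log y • dampedStable α μ x y) s ∧
      HasDerivAt (mellin (dampedStable α μ x))
        (mellin (fun y => Real.log y • dampedStable α μ x y) s) s := by
  obtain ⟨C, hC, hbd⟩ := exists_norm_dampedStable_le hα0 hα1 hx μ
  -- Linear vanishing at 0 gives b = -1, the left edge of the half-plane; exponential decay allows
  -- any a, and Re s + 1 suffices.
  refine mellin_hasDerivAt_of_isBigO_rpow (a := s.re + 1) (b := -1) ?_ ?_ (by linarith) ?_ hs
  · refine IntegrableOn.locallyIntegrableOn ?_
    have h := (integrableOn_rpow_mul_exp_neg_mul (by norm_num : (-1 : ℝ) < 1) one_pos).const_mul C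
    refine h.mono' (measurable_dampedStable α μ x).aestronglyMeasurable ?_
    filter_upwards [ae_restrict_mem measurableSet_Ioi] with y hy
    rw [Real.rpow_one]
    exact hbd y hy
  · have h1 : dampedStable α μ x =O[atTop] fun y => y ^ (1 : ℝ) * Real.exp (-1 * y) := by
      refine Asymptotics.IsBigO.of_bound C ?_
      filter_upwards [eventually_gt_atTop 0] with y hy
      rw [Real.rpow_one, Real.norm_of_nonneg (by positivity), neg_mul]
      exact hbd y hy
    refine h1.trans ?_
    have h2 := (isLittleO_exp_neg_mul_rpow_atTop one_pos (-(s.re + 1) - 1)).isBigO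
    have h3 := (Asymptotics.isBigO_refl (fun y : ℝ => y ^ (1 : ℝ)) atTop).mul h2
    refine h3.trans (EventuallyEq.isBigO ?_)
    filter_upwards [eventually_gt_atTop 0] with y hy
    rw [← Real.rpow_add hy]
    congr 1; ring
  · refine Asymptotics.IsBigO.of_bound C ?_
    filter_upwards [self_mem_nhdsWithin] with y hy
    have hy0 : 0 < y := hy
    rw [neg_neg, Real.rpow_one, Real.norm_of_nonneg hy0.le]
    refine (hbd y hy0).trans ?_
    gcongr
    exact mul_le_of_le_one_right hy0.le (Real.exp_le_one_iff.2 (by linarith))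

/-- Holomorphic extension of the Mittag-Leffler density in the shape parameter. -/
noncomputable def mlHol (α μ x : ℝ) (s : ℂ) : ℂ :=
  (μ : ℂ) ^ s * (Complex.Gamma s)⁻¹ * mellin (dampedStable α μ x) s

lemma differentiableAt_mlHol {α μ x : ℝ} (hα0 : 0 < α) (hα1 : α < 1) (hμ : 0 < μ) (hx : 0 < x)
    {s : ℂ} (hs : -1 < s.re) : DifferentiableAt ℂ (mlHol α μ x) s := by
  have h1 : DifferentiableAt ℂ (fun s : ℂ => (μ : ℂ) ^ s) s :=
    (differentiableAt_id).const_cpow (Or.inl (by exact_mod_cast hμ.ne'))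
  have h2 := Complex.differentiable_one_div_Gamma s
  have h3 := (mellin_dampedStable_hasDerivAt hα0 hα1 hx μ hs).2.differentiableAt
  exact (h1.mul h2).mul h3

/-- The restriction of `mlHol` to the real axis. -/
noncomputable def mlReal (α μ x s : ℝ) : ℝ := (mlHol α μ x s).re

/-- Mathlib's convention Γ(0) = 0 with 0⁻¹ = 0 agrees here with the true zero of the entire function
1/Γ, so this is the genuine limit value. It removes the boundary term later. -/
lemma mlReal_zero (α μ x : ℝ) : mlReal α μ x 0 = 0 := by
  simp [mlReal, mlHol, Complex.Gamma_zero]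

/-- The derivative of `mlReal`. -/
noncomputable def mlRealDeriv (α μ x s : ℝ) : ℝ := (deriv (mlHol α μ x) s).re

lemma hasDerivAt_mlReal {α μ x s : ℝ} (hα0 : 0 < α) (hα1 : α < 1) (hμ : 0 < μ) (hx : 0 < x)
    (hs : -1 < s) : HasDerivAt (mlReal α μ x) (mlRealDeriv α μ x s) s :=
  (differentiableAt_mlHol hα0 hα1 hμ hx (by simpa using hs)).hasDerivAt.real_of_complex

lemma continuousAt_mlRealDeriv {α μ x s : ℝ} (hα0 : 0 < α) (hα1 : α < 1) (hμ : 0 < μ) (hx : 0 < x)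
    (hs : -1 < s) : ContinuousAt (mlRealDeriv α μ x) s := by
  have hopen : IsOpen {w : ℂ | -1 < w.re} := isOpen_lt continuous_const Complex.continuous_re
  have h : AnalyticOnNhd ℂ (mlHol α μ x) {w : ℂ | -1 < w.re} :=
    DifferentiableOn.analyticOnNhd
      (fun w hw => (differentiableAt_mlHol hα0 hα1 hμ hx hw).differentiableWithinAt) hopen
  have h1 : ContinuousAt (deriv (mlHol α μ x)) (s : ℂ) :=
    (h.deriv (s : ℂ) (by simpa using hs)).continuousAt
  exact Complex.continuous_re.continuousAt.comp
    (ContinuousAt.comp (g := deriv (mlHol α μ x)) h1 Complex.continuous_ofReal.continuousAt)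

lemma mellin_ofReal (f : ℝ → ℝ) (s : ℝ) :
    mellin (fun y => (f y : ℂ)) s = ((∫ y in Ioi (0 : ℝ), y ^ (s - 1) * f y : ℝ) : ℂ) := by
  rw [mellin, ← integral_complex_ofReal]
  refine setIntegral_congr_fun measurableSet_Ioi fun y hy => ?_
  have hy0 : (0 : ℝ) < y := hy
  simp only [smul_eq_mul]
  rw [Complex.ofReal_mul, Complex.ofReal_cpow hy0.le]
  push_cast
  rfl

lemma mlDensity_eq_mlReal {α ρ μ x t : ℝ} (hα0 : 0 < α) (hα1 : α < 1) (hρ : 0 < ρ) (hμ : 0 < μ)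
    (hx : 0 < x) (ht : 0 < t) : mlDensity α ρ μ x t = mlReal α μ x (ρ * t) := by
  have h := mellin_ofReal (fun y => Real.exp (-(μ * y)) * stableDensity α x y) (ρ * t)
  rw [mlDensity_eq_integral hα0 hα1 hρ hμ hx ht, mlReal, mlHol,
    show dampedStable α μ x = fun y =>
      ((Real.exp (-(μ * y)) * stableDensity α x y : ℝ) : ℂ) from rfl, h,
    ← Complex.ofReal_cpow hμ.le, Complex.Gamma_ofReal, ← Complex.ofReal_inv, ← Complex.ofReal_mul,
    ← Complex.ofReal_mul, Complex.ofReal_re, div_eq_mul_inv]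

lemma integrableOn_log_mul_gammaDensity {α ρ μ x t : ℝ} (hα0 : 0 < α) (hα1 : α < 1) (hρ : 0 < ρ)
    (hx : 0 < x) (ht : 0 < t) :
    IntegrableOn (fun y => stableDensity α x y * Real.log y * gammaDensity ρ μ y t) (Ioi 0) := by
  have h := (mellin_dampedStable_hasDerivAt hα0 hα1 hx μ
    (s := ((ρ * t : ℝ) : ℂ)) (by rw [Complex.ofReal_re]; have := mul_pos hρ ht; linarith)).1
  have h' : IntegrableOn (fun y : ℝ => μ ^ (ρ * t) / Real.Gamma (ρ * t) *
      ((y : ℂ) ^ (((ρ * t : ℝ) : ℂ) - 1) • Real.log y • dampedStable α μ x y).re) (Ioi 0) :=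
    (Integrable.re h).const_mul _
  refine h'.congr_fun (fun y hy => ?_) measurableSet_Ioi
  have hy0 : (0 : ℝ) < y := hy
  simp only [dampedStable]
  rw [← Complex.ofReal_one, ← Complex.ofReal_sub, ← Complex.ofReal_cpow hy0.le, Complex.real_smul,
    smul_eq_mul, ← Complex.ofReal_mul, ← Complex.ofReal_mul, Complex.ofReal_re, gammaDensity,
    gammaPDFReal, if_pos hy0.le]
  ring

/-- The real part loses nothing: Γ is real on the real axis, so differentiating its restriction in
two ways shows that Γ'(s) is real. -/
lemma digamma_eq {s : ℝ} (hs : 0 < s) :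
    ((digamma s : ℝ) : ℂ) = deriv Complex.Gamma s / Complex.Gamma s := by
  have hd : DifferentiableAt ℂ Complex.Gamma s :=
    Complex.differentiableAt_Gamma _ fun m h => by
      have h' : s = -(m : ℝ) := by exact_mod_cast h
      have : (0 : ℝ) ≤ m := by positivity
      linarith
  have hG : (fun x : ℝ => Complex.Gamma x) = fun x : ℝ => ((Real.Gamma x : ℝ) : ℂ) := by
    ext x; exact Complex.Gamma_ofReal x
  have h1 := hd.hasDerivAt.comp_ofReal
  have h2 : HasDerivAt (fun x : ℝ => ((Real.Gamma x : ℝ) : ℂ)) _ s :=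
    hd.hasDerivAt.real_of_complex.ofReal_comp
  rw [hG] at h1
  have h3 := h1.unique h2
  rw [digamma, Complex.digamma, logDeriv_apply, h3, Complex.Gamma_ofReal, ← Complex.ofReal_div,
    Complex.ofReal_re]

lemma mlBracket_eq_mlRealDeriv {α ρ μ x t : ℝ} (hα0 : 0 < α) (hα1 : α < 1) (hρ : 0 < ρ)
    (hμ : 0 < μ) (hx : 0 < x) (ht : 0 < t) :
    mlBracket α ρ μ x t = mlRealDeriv α μ x (ρ * t) := by
  have hs : 0 < ρ * t := mul_pos hρ ht
  have hΓ : Complex.Gamma ((ρ * t : ℝ) : ℂ) ≠ 0 := by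
    rw [Complex.Gamma_ofReal]; exact_mod_cast (Real.Gamma_pos_of_pos hs).ne'
  have hd : DifferentiableAt ℂ Complex.Gamma ((ρ * t : ℝ) : ℂ) :=
    Complex.differentiableAt_Gamma _ fun m h => by
      have h' : ρ * t = -(m : ℝ) := by exact_mod_cast h
      have : (0 : ℝ) ≤ m := by positivity
      linarith
  have hμ' : (μ : ℂ) ≠ 0 := by exact_mod_cast hμ.ne'
  have h1 : HasDerivAt (fun s : ℂ => (μ : ℂ) ^ s) _ ((ρ * t : ℝ) : ℂ) :=
    (hasDerivAt_id _).const_cpow (Or.inl hμ')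
  have h2 := hd.hasDerivAt.inv hΓ
  have h3 := (mellin_dampedStable_hasDerivAt hα0 hα1 hx μ
    (s := ((ρ * t : ℝ) : ℂ)) (by rw [Complex.ofReal_re]; linarith)).2
  have hD : deriv (mlHol α μ x) ((ρ * t : ℝ) : ℂ) = _ := ((h1.mul h2).mul h3).deriv
  have hψ := digamma_eq hs
  have hint : ∫ y in Ioi (0 : ℝ), stableDensity α x y * Real.log y * gammaDensity ρ μ y t =
      μ ^ (ρ * t) / Real.Gamma (ρ * t) * ∫ y in Ioi (0 : ℝ), y ^ (ρ * t - 1) *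
        (Real.log y * (Real.exp (-(μ * y)) * stableDensity α x y)) := by
    rw [← integral_const_mul]
    refine setIntegral_congr_fun measurableSet_Ioi fun y hy => ?_
    have hy0 : (0 : ℝ) < y := hy
    simp only [gammaDensity, gammaPDFReal, if_pos hy0.le]
    ring
  have hmel : mellin (fun y => Real.log y • dampedStable α μ x y) ((ρ * t : ℝ) : ℂ) =
      ((∫ y in Ioi (0 : ℝ), y ^ (ρ * t - 1) *
        (Real.log y * (Real.exp (-(μ * y)) * stableDensity α x y)) : ℝ) : ℂ) := by
    rw [← mellin_ofReal]
    congr 1 with y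
    simp only [dampedStable, Complex.real_smul, Complex.ofReal_mul]
  have hmel0 : mellin (dampedStable α μ x) ((ρ * t : ℝ) : ℂ) = _ :=
    mellin_ofReal (fun y => Real.exp (-(μ * y)) * stableDensity α x y) (ρ * t)
  have key : deriv (mlHol α μ x) ((ρ * t : ℝ) : ℂ) = (mlBracket α ρ μ x t : ℝ) := by
    have hΓ' : deriv Complex.Gamma ((ρ * t : ℝ) : ℂ) =
        digamma (ρ * t) * Complex.Gamma ((ρ * t : ℝ) : ℂ) := by
      rw [hψ, div_mul_cancel₀ _ hΓ]
    rw [hD, mlBracket, hint, mlDensity_eq_integral hα0 hα1 hρ hμ hx ht, hmel, hmel0]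
    simp only [Pi.mul_apply, Pi.inv_apply, id]
    rw [hΓ', Complex.Gamma_ofReal, ← Complex.ofReal_cpow hμ.le, ← Complex.ofReal_log hμ.le]
    norm_cast
    have := (Real.Gamma_pos_of_pos hs).ne'
    field_simp
    ring
  rw [mlRealDeriv, key, Complex.ofReal_re]

/-! ### Differentiating Riemann-Liouville integrals. -/

lemma rlIntegral_congr {ν t : ℝ} {f g : ℝ → ℝ} (ht : 0 < t) (h : ∀ u ∈ Ioc 0 t, f u = g u) :
    rlIntegral ν f t = rlIntegral ν g t := by
  rw [rlIntegral, rlIntegral]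
  split_ifs
  · exact h t ⟨ht, le_rfl⟩
  · congr 1
    refine intervalIntegral.integral_congr_ae (ae_of_all _ fun u hu => ?_)
    rw [uIoc_of_le ht.le] at hu
    rw [h u hu]

lemma rlIntegral_const_mul (ν r : ℝ) (f : ℝ → ℝ) (t : ℝ) :
    rlIntegral ν (fun u => r * f u) t = r * rlIntegral ν f t := by
  rw [rlIntegral, rlIntegral]
  split_ifs
  · rfl
  · have h : ∀ u, (t - u) ^ (ν - 1) * (r * f u) = r * ((t - u) ^ (ν - 1) * f u) := fun u => by
      ring
    simp_rw [h, intervalIntegral.integral_const_mul]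
    ring

lemma rlIntegrable_of_continuousOn {ν t : ℝ} {f g : ℝ → ℝ} (hν : 0 ≤ ν) (ht : 0 < t)
    (hg : ContinuousOn g (Icc 0 t)) (h : ∀ u ∈ Ioc 0 t, f u = g u) : RLIntegrable ν f t := by
  rcases hν.eq_or_lt with rfl | hν
  · exact Or.inl rfl
  · refine Or.inr ?_
    have h1 : IntervalIntegrable (fun u => (t - u) ^ (ν - 1)) volume 0 t := by
      have := (intervalIntegral.intervalIntegrable_rpow' (a := 0) (b := t)
        (by linarith : -1 < ν - 1)).comp_sub_left t
      simpa using this.symm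
    refine (h1.mul_continuousOn (by rwa [uIcc_of_le ht.le])).congr ?_
    intro u hu
    rw [uIoc_of_le ht.le] at hu
    simp only [h u hu]

/-- Differentiation of a Riemann-Liouville convolution whose second factor vanishes at `0`. -/
lemma hasDerivAt_integral_sub_rpow_mul {ν t : ℝ} {p p' : ℝ → ℝ} (hν : 0 < ν) (ht : 0 < t)
    (hp : ∀ s, 0 ≤ s → HasDerivAt p (p' s) s) (hp' : ContinuousOn p' (Ici 0)) (h0 : p 0 = 0) :
    HasDerivAt (fun t => ∫ u in (0 : ℝ)..t, (t - u) ^ (ν - 1) * p u)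
      (∫ u in (0 : ℝ)..t, (t - u) ^ (ν - 1) * p' u) t := by
  set T := t + 1 with hT
  -- The substitution w = s - u frees the singular kernel of the parameter s; the indicator then
  -- fixes the domain as (0, T].
  have hshift : ∀ (f : ℝ → ℝ) (s : ℝ), 0 < s → s < T →
      ∫ u in (0 : ℝ)..s, (s - u) ^ (ν - 1) * f u =
        ∫ w in Ioc 0 T, w ^ (ν - 1) * (Iio s).indicator (fun w => f (s - w)) w := by
    intro f s hs hsT
    have h1 := intervalIntegral.integral_comp_sub_left (a := 0) (b := s)
      (fun w => w ^ (ν - 1) * f (s - w)) s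
    simp only [sub_sub_cancel, sub_self, sub_zero] at h1
    have h2 : ∀ w, w ^ (ν - 1) * (Iio s).indicator (fun w => f (s - w)) w =
        (Iio s).indicator (fun w => w ^ (ν - 1) * f (s - w)) w := fun w => by
      by_cases hw : w ∈ Iio s <;> simp [hw]
    simp_rw [h1, h2]
    rw [setIntegral_indicator measurableSet_Iio, intervalIntegral.integral_of_le hs.le,
      integral_Ioc_eq_integral_Ioo]
    congr 2
    ext w
    constructor
    · rintro ⟨h1, h2⟩; exact ⟨⟨h1, (h2.trans hsT).le⟩, h2⟩
    · rintro ⟨h1, h2⟩; exact ⟨h1.1, h2⟩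
  obtain ⟨M, hM⟩ := (isCompact_Icc (a := (0 : ℝ)) (b := T)).exists_bound_of_continuousOn
    (hp'.mono Icc_subset_Ici_self)
  have hM0 : 0 ≤ M := (norm_nonneg _).trans (hM 0 ⟨le_rfl, by linarith⟩)
  -- Because p(0) = 0, cutting off at w = s amounts to extending p by zero, which keeps it Lipschitz
  -- on (-∞, T].
  set q : ℝ → ℝ := fun u => p (max u 0) with hq
  have hqp : ∀ s w, (Iio s).indicator (fun w => p (s - w)) w = q (s - w) := fun s w => by
    by_cases hw : w < s
    · simp [hq, hw, max_eq_left (sub_pos.2 hw).le]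
    · simp [hq, hw, max_eq_right (sub_nonpos.2 (not_lt.1 hw)), h0]
  have hqc : Continuous q := by
    have : ContinuousOn p (Ici 0) := fun s hs => (hp s hs).continuousAt.continuousWithinAt
    exact this.comp_continuous (by fun_prop) fun u => le_max_right u 0
  have hp'c : Continuous fun u => p' (max u 0) :=
    hp'.comp_continuous (by fun_prop) fun u => le_max_right u 0
  have hlip : ∀ a b, a ≤ T → b ≤ T → |q a - q b| ≤ M * |a - b| := fun a b ha hb => by
    have hT0 : 0 ≤ T := by linarith
    have h := (convex_Icc (0 : ℝ) T).norm_image_sub_le_of_norm_hasDerivWithin_le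
      (fun s hs => (hp s hs.1).hasDerivWithinAt) (fun s hs => hM s hs)
      (x := max b 0) (y := max a 0) ⟨le_max_right _ _, max_le hb hT0⟩
      ⟨le_max_right _ _, max_le ha hT0⟩
    refine h.trans ?_
    gcongr
    have := abs_max_sub_max_le_max a 0 b 0
    simpa using this
  have hwi : IntegrableOn (fun w : ℝ => w ^ (ν - 1)) (Ioc 0 T) :=
    (intervalIntegrable_iff_integrableOn_Ioc_of_le (by linarith)).1
      (intervalIntegral.intervalIntegrable_rpow' (by linarith))
  have hwm : AEStronglyMeasurable (fun w : ℝ => w ^ (ν - 1)) (volume.restrict (Ioc 0 T)) :=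
    hwi.aestronglyMeasurable
  -- The extension may have a corner at 0, so the integrand is differentiable in s only for w ≠ t;
  -- the Lipschitz form of dominated differentiation tolerates this null set.
  have main := hasDerivAt_integral_of_dominated_loc_of_lip (μ := volume.restrict (Ioc 0 T))
    (𝕜 := ℝ) (x₀ := t) (s := Ioo 0 T) (F := fun s w => w ^ (ν - 1) * q (s - w))
    (F' := fun w => w ^ (ν - 1) * (Iio t).indicator (fun w => p' (t - w)) w)
    (bound := fun w => w ^ (ν - 1) * M) (Ioo_mem_nhds ht (by linarith))
    (Eventually.of_forall fun s => hwm.mul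
      (hqc.comp (continuous_const.sub continuous_id)).aestronglyMeasurable)
    ?_ ?_ ?_ (hwi.mul_const M) ?_
  · rw [hshift p' t ht (by linarith)]
    refine main.2.congr_of_eventuallyEq ?_
    filter_upwards [Ioo_mem_nhds ht (by linarith : t < T)] with s hs
    rw [hshift p s hs.1 hs.2]
    simp_rw [hqp]
  · have hc : ContinuousOn (fun w => q (t - w)) (Icc 0 T) :=
      (hqc.comp (continuous_const.sub continuous_id)).continuousOn
    obtain ⟨B, hB⟩ := isCompact_Icc.exists_bound_of_continuousOn hc
    refine hwi.mul_bdd (c := B)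
      (hqc.comp (continuous_const.sub continuous_id)).aestronglyMeasurable ?_
    filter_upwards [ae_restrict_mem measurableSet_Ioc] with w hw
    exact hB w ⟨hw.1.le, hw.2⟩
  · refine hwm.mul ?_
    have e : (Iio t).indicator (fun w => p' (t - w)) =
        (Iio t).indicator (fun w => p' (max (t - w) 0)) := by
      refine indicator_congr fun w hw => ?_
      rw [max_eq_left (sub_nonneg.2 (le_of_lt hw))]
    rw [e]
    exact ((hp'c.comp (continuous_const.sub continuous_id)).aestronglyMeasurable).indicator
      measurableSet_Iio
  · filter_upwards [ae_restrict_mem measurableSet_Ioc] with w hw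
    refine LipschitzOnWith.of_dist_le_mul fun a ha b hb => ?_
    have hw0 : 0 ≤ w ^ (ν - 1) := Real.rpow_nonneg hw.1.le _
    rw [Real.dist_eq, Real.dist_eq, ← mul_sub, abs_mul, abs_of_nonneg hw0, Real.coe_nnabs,
      abs_of_nonneg (mul_nonneg hw0 hM0), mul_assoc]
    gcongr
    have := hlip (a - w) (b - w) (by linarith [ha.2, hw.1]) (by linarith [hb.2, hw.1])
    simpa using this
  · have hne : ∀ᵐ w ∂(volume.restrict (Ioc 0 T)), w ≠ t :=
      ae_restrict_of_ae (Measure.ae_ne volume t)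
    filter_upwards [hne] with w hw
    refine HasDerivAt.const_mul _ ?_
    rcases hw.lt_or_gt with h | h
    · have h1 : HasDerivAt (fun s => p (s - w)) (p' (t - w)) t := by
        simpa [Function.comp_def] using
          (hp (t - w) (sub_pos.2 h).le).comp t ((hasDerivAt_id t).sub_const w)
      rw [indicator_of_mem (show w ∈ Iio t from h)]
      refine h1.congr_of_eventuallyEq ?_
      filter_upwards [lt_mem_nhds h] with s hs
      rw [hq]
      simp only [max_eq_left (sub_pos.2 hs).le]
    · rw [indicator_of_notMem (by simpa using h.le)]
      refine (hasDerivAt_const t (0 : ℝ)).congr_of_eventuallyEq ?_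
      filter_upwards [gt_mem_nhds h] with s hs
      rw [hq]
      simp only [max_eq_right (sub_neg.2 hs).le, h0]

lemma hasDerivAt_rlIntegral {ν t : ℝ} {p p' : ℝ → ℝ} (hν : 0 ≤ ν) (ht : 0 < t)
    (hp : ∀ s, 0 ≤ s → HasDerivAt p (p' s) s) (hp' : ContinuousOn p' (Ici 0)) (h0 : p 0 = 0) :
    HasDerivAt (rlIntegral ν p) (rlIntegral ν p' t) t := by
  rcases hν.eq_or_lt with rfl | hν
  · have h : ∀ f : ℝ → ℝ, rlIntegral 0 f = f := fun f => by ext s; simp [rlIntegral]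
    rw [h, h]
    exact hp t ht.le
  · have h : ∀ f : ℝ → ℝ, rlIntegral ν f = fun t =>
        (Real.Gamma ν)⁻¹ * ∫ u in (0 : ℝ)..t, (t - u) ^ (ν - 1) * f u := fun f => by
      ext s; simp [rlIntegral, hν.ne']
    rw [h, h]
    exact (hasDerivAt_integral_sub_rpow_mul hν ht hp hp' h0).const_mul _

end FracML

theorem mainTheorem4 (α ρ μ τ : ℝ) (hα0 : 0 < α) (hα1 : α < 1) (hρ : 0 < ρ) (hμ : 0 < μ)
    (hτ0 : 0 < τ) (hτ1 : τ ≤ 1) (x t : ℝ) (hx : 0 < x) (ht : 0 < t) :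
    IntegrableOn
      (fun y => FracML.stableDensity α x y * Real.log y * FracML.gammaDensity ρ μ y t) (Ioi 0) ∧
    FracML.RLIntegrable (1 - τ) (fun s => FracML.mlDensity α ρ μ x s) t ∧
    FracML.RLIntegrable (1 - τ) (fun s => FracML.mlBracket α ρ μ x s) t ∧
    DifferentiableAt ℝ (FracML.rlIntegral (1 - τ) (fun s => FracML.mlDensity α ρ μ x s)) t ∧
    FracML.rlDeriv τ (fun s => FracML.mlDensity α ρ μ x s) t =
      ρ * FracML.rlDeriv (τ - 1) (fun s => FracML.mlBracket α ρ μ x s) t := by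
  have hν : 0 ≤ 1 - τ := by linarith
  have hneg : ∀ s : ℝ, 0 ≤ s → -1 < ρ * s := fun s hs => by
    have := mul_nonneg hρ.le hs
    linarith
  have hp : ∀ s : ℝ, 0 ≤ s → HasDerivAt (fun s => FracML.mlReal α μ x (ρ * s))
      (ρ * FracML.mlRealDeriv α μ x (ρ * s)) s := fun s hs => by
    have h := (FracML.hasDerivAt_mlReal hα0 hα1 hμ hx (hneg s hs)).comp s
      ((hasDerivAt_id s).const_mul ρ)
    exact h.congr_deriv (by ring)
  have hb : ContinuousOn (fun s => FracML.mlRealDeriv α μ x (ρ * s)) (Ici 0) := fun s hs =>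
    (ContinuousAt.comp (g := FracML.mlRealDeriv α μ x) (f := fun s => ρ * s)
      (FracML.continuousAt_mlRealDeriv hα0 hα1 hμ hx (hneg s hs))
      (by fun_prop)).continuousWithinAt
  have hpc : ContinuousOn (fun s => FracML.mlReal α μ x (ρ * s)) (Ici 0) := fun s hs =>
    (hp s hs).continuousAt.continuousWithinAt
  have hdens : ∀ s, 0 < s → FracML.mlDensity α ρ μ x s = FracML.mlReal α μ x (ρ * s) :=
    fun s hs => FracML.mlDensity_eq_mlReal hα0 hα1 hρ hμ hx hs
  have hbr : ∀ s, 0 < s → FracML.mlBracket α ρ μ x s = FracML.mlRealDeriv α μ x (ρ * s) :=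
    fun s hs => FracML.mlBracket_eq_mlRealDeriv hα0 hα1 hρ hμ hx hs
  have hmain : HasDerivAt (FracML.rlIntegral (1 - τ) (fun s => FracML.mlDensity α ρ μ x s))
      (ρ * FracML.rlIntegral (1 - τ) (fun s => FracML.mlBracket α ρ μ x s) t) t := by
    have h := FracML.hasDerivAt_rlIntegral hν ht hp (hb.const_smul ρ)
      (by simp [FracML.mlReal_zero])
    rw [FracML.rlIntegral_const_mul] at h
    -- The identifications with F and F' hold for positive times only, which suffices: the operators
    -- see their argument only on (0, t].
    rw [FracML.rlIntegral_congr ht fun u hu => hbr u hu.1]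
    refine h.congr_of_eventuallyEq ?_
    filter_upwards [lt_mem_nhds ht] with s hs
    exact FracML.rlIntegral_congr hs fun u hu => hdens u hu.1
  refine ⟨FracML.integrableOn_log_mul_gammaDensity hα0 hα1 hρ hx ht,
    FracML.rlIntegrable_of_continuousOn hν ht (hpc.mono Icc_subset_Ici_self)
      fun u hu => hdens u hu.1,
    FracML.rlIntegrable_of_continuousOn hν ht (hb.mono Icc_subset_Ici_self)
      fun u hu => hbr u hu.1, hmain.differentiableAt, ?_⟩
  -- For 0 < τ ≤ 1 the operator of order τ is one derivative of the integral of order 1 - τ, while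
  -- order τ - 1 is that integral alone.
  have hc1 : ⌈τ⌉₊ = 1 := by
    rw [Nat.ceil_eq_iff one_ne_zero]
    simp [hτ0, hτ1]
  have hc0 : ⌈τ - 1⌉₊ = 0 := Nat.ceil_eq_zero.2 (by linarith)
  rw [FracML.rlDeriv, FracML.rlDeriv, hc1, hc0, iteratedDeriv_one, iteratedDeriv_zero,
    Nat.cast_one, hmain.deriv, Nat.cast_zero, zero_sub, neg_sub]
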